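/- Let $\Omega\subseteq\mathbb{C}$ be a bounded domain (non-empty, connected, open set) with $C^2$ boundary, i.e. $\partial\Omega$ is, near each of its points and after a rigid motion of the plane, the graph of a $C^2$ function of one real variable. Let $P\in\Omega$, let $(\varphi_j)_{j\in\mathbb{N}}$ be a sequence of holomorphic maps from $\Omega$ to $\Omega$, and suppose that $\varphi_j(P)\to w$ for some $w\in\partial\Omega$. If $K\subseteq\Omega$ is compact and $V$ is a neighbourhood of $w$ in $\mathbb{C}$, then there exists a positive integer $J$ such that $\varphi_j(K)\subseteq V$ for all $j\ge J$. -/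

import Mathlib

/-- The boundary of `Ω ⊆ ℂ` is `C²`: near each of its points `p` it is, in Euclidean coordinates
centred at `p` (rotated by a unit complex number `a`), the graph of a `C²` real function of one
real variable. -/
def HasC2Boundary (Ω : Set ℂ) : Prop :=
  ∀ p ∈ frontier Ω, ∃ a : ℂ, ‖a‖ = 1 ∧ ∃ r : ℝ, 0 < r ∧ ∃ f : ℝ → ℝ,
    ContDiffOn ℝ 2 f (Set.Ioo (-r) r) ∧
    ∀ z ∈ Metric.ball p r, z ∈ frontier Ω ↔ ((z - p) / a).im = f ((z - p) / a).re

/-! As `w ∉ Ω`, each `φ j - w` is zero-free on `Ω`; divided by a bound `D`, it has modulus at most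
1, so minus the log of its modulus is a nonnegative harmonic function. Harnack
(`norm_pow_three_le_of_ne_zero`) then makes convergence to `w` at the centre of a disc in `Ω`
uniform on the half disc. Connectedness carries convergence from `P` to every point, and compactness
covers `K` by finitely many half discs. -/

open Metric in
/-- A zero-free holomorphic function on a disc has a holomorphic logarithm there. -/
theorem exists_differentiableOn_ball_exp_eq {f : ℂ → ℂ} {c : ℂ} {R : ℝ}
    (hf : DifferentiableOn ℂ f (ball c R)) (h0 : ∀ z ∈ ball c R, f z ≠ 0) :
    ∃ g : ℂ → ℂ, DifferentiableOn ℂ g (ball c R) ∧ ∀ z ∈ ball c R, Complex.exp (g z) = f z := by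
  rcases le_or_gt R 0 with hR | hR
  · exact ⟨0, differentiableOn_const 0, by simp [ball_eq_empty.2 hR]⟩
  have hc : c ∈ ball c R := mem_ball_self hR
  have hd : DifferentiableOn ℂ (fun z => deriv f z / f z) (ball c R) :=
    (hf.deriv isOpen_ball).div hf h0
  obtain ⟨g, hgc, hg⟩ := hd.isExactOn_ball.with_val_at c (Complex.log (f c))
  have hfd : ∀ z ∈ ball c R, HasDerivAt f (deriv f z) z := fun z hz =>
    (hf.differentiableAt (isOpen_ball.mem_nhds hz)).hasDerivAt
  have hq : ∀ z ∈ ball c R, HasDerivAt (fun z => Complex.exp (g z) / f z) 0 z := fun z hz => by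
    refine ((hg z hz).cexp.div (hfd z hz) (h0 z hz)).congr_deriv ?_
    have := h0 z hz
    field_simp
    ring
  refine ⟨g, fun z hz => (hg z hz).differentiableAt.differentiableWithinAt, fun z hz => ?_⟩
  have hconst : Complex.exp (g z) / f z = Complex.exp (g c) / f c :=
    isOpen_ball.is_const_of_deriv_eq_zero (convex_ball c R).isPreconnected
      (fun x hx => (hq x hx).differentiableAt.differentiableWithinAt)
      (fun x hx => (hq x hx).deriv) hz hc
  rw [hgc, Complex.exp_log (h0 c hc), div_self (h0 c hc)] at hconst
  exact (div_eq_one_iff_eq (h0 z hz)).1 hconst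

open Metric in
/-- Harnack's inequality for a holomorphic function with values in the closed left half-plane. -/
theorem three_mul_re_le_of_re_nonpos {g : ℂ → ℂ} {c z : ℂ} {R : ℝ}
    (hg : DifferentiableOn ℂ g (ball c R)) (h0 : ∀ z ∈ ball c R, (g z).re ≤ 0)
    (hz : z ∈ ball c (R / 2)) : 3 * (g z).re ≤ (g c).re := by
  have hzc : dist z c < R / 2 := hz
  have hR : 0 < R := by linarith [dist_nonneg (x := z) (y := c)]
  have hzR : z ∈ ball c R := ball_subset_ball (by linarith) hz
  have hc := h0 c (mem_ball_self hR)
  have hz0 := h0 z hzR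
  rcases hc.lt_or_eq with hc | hc
  swap
  · linarith
  set a := g c with ha
  -- The Cayley transform `(g - a) / (g + conj a)` sends the left half-plane into the unit disc and
  -- `a` to 0; the Schwarz lemma bounds it by 1/2 on the half disc.
  have hne : ∀ x ∈ ball c R, g x + (starRingEnd ℂ) a ≠ 0 := fun x hx h => by
    have := congrArg Complex.re h
    simp only [Complex.add_re, Complex.conj_re, Complex.zero_re] at this
    linarith [h0 x hx]
  have hle : ∀ x ∈ ball c R, ‖g x - a‖ ≤ ‖g x + (starRingEnd ℂ) a‖ := fun x hx => by
    rw [← sq_le_sq₀ (norm_nonneg _) (norm_nonneg _), Complex.sq_norm, Complex.sq_norm,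
      Complex.normSq_apply, Complex.normSq_apply]
    simp only [Complex.sub_re, Complex.sub_im, Complex.add_re, Complex.add_im, Complex.conj_re,
      Complex.conj_im]
    nlinarith [h0 x hx, mul_nonneg_of_nonpos_of_nonpos (h0 x hx) hc.le]
  have hu : dist ((g z - a) / (g z + (starRingEnd ℂ) a)) ((g c - a) / (g c + (starRingEnd ℂ) a))
      ≤ 1 / R * dist z c := by
    refine Complex.dist_le_div_mul_dist_of_mapsTo_ball
      (f := fun x => (g x - a) / (g x + (starRingEnd ℂ) a))
      ((hg.sub_const a).div (hg.add_const _) hne) (fun x hx => ?_) hzR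
    simp only [← ha, sub_self, zero_div, mem_closedBall_zero_iff, norm_div]
    exact div_le_one_of_le₀ (hle x hx) (norm_nonneg _)
  have hhalf : 1 / R * dist z c ≤ 1 / 2 := by
    rw [one_div_mul_eq_div, div_le_iff₀ hR]
    linarith
  rw [← ha, sub_self, zero_div, dist_zero_right, norm_div] at hu
  have key := (div_le_iff₀ (norm_pos_iff.2 (hne z hzR))).1 (hu.trans hhalf)
  have key2 := pow_le_pow_left₀ (norm_nonneg _) key 2
  rw [mul_pow, Complex.sq_norm, Complex.sq_norm, Complex.normSq_apply, Complex.normSq_apply] at key2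
  simp only [Complex.sub_re, Complex.sub_im, Complex.add_re, Complex.add_im, Complex.conj_re,
    Complex.conj_im] at key2
  -- Both sides contain the square of `(g z).im - a.im`, with coefficient 4 on the left and 1 on the
  -- right, so it can be dropped.
  have hsq : (2 * ((g z).re - a.re)) ^ 2 ≤ ((g z).re + a.re) ^ 2 := by
    nlinarith [sq_nonneg ((g z).im - a.im)]
  have habs := abs_le_of_sq_le_sq' (sq_abs ((g z).re + a.re) ▸ hsq) (abs_nonneg _)
  rw [abs_of_nonpos (by linarith)] at habs
  linarith [habs.2]

open Metric in
/-- Harnack's inequality for `-log ‖f‖`, where `f` is zero-free and bounded by `1` on a disc. -/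
theorem norm_pow_three_le_of_ne_zero {f : ℂ → ℂ} {c z : ℂ} {R : ℝ}
    (hf : DifferentiableOn ℂ f (ball c R)) (h0 : ∀ z ∈ ball c R, f z ≠ 0)
    (h1 : ∀ z ∈ ball c R, ‖f z‖ ≤ 1) (hz : z ∈ ball c (R / 2)) : ‖f z‖ ^ 3 ≤ ‖f c‖ := by
  have hzc : dist z c < R / 2 := hz
  have hR : 0 < R := by linarith [dist_nonneg (x := z) (y := c)]
  obtain ⟨g, hg, hexp⟩ := exists_differentiableOn_ball_exp_eq hf h0
  have hnorm : ∀ x ∈ ball c R, ‖f x‖ = Real.exp (g x).re := fun x hx => by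
    rw [← hexp x hx, Complex.norm_exp]
  have := three_mul_re_le_of_re_nonpos hg
    (fun x hx => Real.exp_le_one_iff.1 (hnorm x hx ▸ h1 x hx)) hz
  rw [hnorm z (ball_subset_ball (by linarith) hz), hnorm c (mem_ball_self hR), ← Real.exp_nat_mul]
  exact Real.exp_le_exp.2 (by simpa using this)

open Metric Filter Topology in
/-- If uniformly bounded holomorphic functions omit the value `w` on a disc and converge to `w` at
its centre, then they converge to `w` uniformly on the disc of half the radius. -/
theorem tendstoUniformlyOn_ball_of_tendsto_center {φ : ℕ → ℂ → ℂ} {c w : ℂ} {R D : ℝ} (hD : 0 < D)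
    (hφ : ∀ j, DifferentiableOn ℂ (φ j) (ball c R)) (hne : ∀ j, ∀ z ∈ ball c R, φ j z ≠ w)
    (hb : ∀ j, ∀ z ∈ ball c R, dist (φ j z) w ≤ D)
    (hlim : Tendsto (fun j => φ j c) atTop (𝓝 w)) :
    TendstoUniformlyOn φ (fun _ => w) atTop (ball c (R / 2)) := by
  rw [Metric.tendstoUniformlyOn_iff]
  intro ε hε
  -- The cube offsets the exponent 3 in Harnack's inequality.
  have hδ : 0 < D * (ε / D) ^ 3 := by positivity
  filter_upwards [Metric.tendsto_nhds.1 hlim _ hδ] with j hj z hz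
  have h := norm_pow_three_le_of_ne_zero (f := fun x => (φ j x - w) / D)
    (((hφ j).sub_const w).div_const _)
    (fun x hx => div_ne_zero (sub_ne_zero.2 (hne j x hx)) (by exact_mod_cast hD.ne'))
    (fun x hx => by
      rw [norm_div, Complex.norm_real, Real.norm_of_nonneg hD.le, ← dist_eq_norm]
      exact div_le_one_of_le₀ (hb j x hx) hD.le) hz
  simp only [norm_div, Complex.norm_real, Real.norm_of_nonneg hD.le, ← dist_eq_norm] at h
  have h2 : (dist (φ j z) w / D) ^ 3 < (ε / D) ^ 3 :=
    h.trans_lt ((div_lt_iff₀ hD).2 (by linarith))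
  rw [dist_comm]
  exact (div_lt_div_iff_of_pos_right hD).1 (lt_of_pow_lt_pow_left₀ 3 (by positivity) h2)

theorem lemma22 (Ω : Set ℂ) (hΩ_open : IsOpen Ω) (hΩ_conn : IsConnected Ω)
    (hΩ_bdd : Bornology.IsBounded Ω) (hΩ_C2 : HasC2Boundary Ω)
    (P : ℂ) (hP : P ∈ Ω) (φ : ℕ → ℂ → ℂ)
    (hφ_hol : ∀ j, DifferentiableOn ℂ (φ j) Ω)
    (hφ_maps : ∀ j, Set.MapsTo (φ j) Ω Ω)
    (w : ℂ) (hw : w ∈ frontier Ω)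
    (hlim : Filter.Tendsto (fun j => φ j P) Filter.atTop (nhds w)) :
    ∀ K : Set ℂ, K ⊆ Ω → IsCompact K → ∀ V ∈ nhds w,
      ∃ J : ℕ, 0 < J ∧ ∀ j : ℕ, J ≤ j → φ j '' K ⊆ V := by
  have hwΩ : w ∉ Ω := by
    rw [hΩ_open.frontier_eq] at hw
    exact hw.2
  obtain ⟨D, hD, hΩD⟩ := hΩ_bdd.subset_closedBall_lt 0 w
  have hunif : ∀ (c : ℂ) (R : ℝ), Metric.ball c R ⊆ Ω →
      Filter.Tendsto (fun j => φ j c) Filter.atTop (nhds w) →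
      TendstoUniformlyOn φ (fun _ => w) Filter.atTop (Metric.ball c (R / 2)) := fun c R hR hc =>
    tendstoUniformlyOn_ball_of_tendsto_center hD (fun j => (hφ_hol j).mono hR)
      (fun j z hz h => hwΩ (h ▸ hφ_maps j (hR hz))) (fun j z hz => hΩD (hφ_maps j (hR hz))) hc
  have hpt : ∀ y ∈ Ω, Filter.Tendsto (fun j => φ j y) Filter.atTop (nhds w) := fun y hy => by
    refine hΩ_conn.isPreconnected.induction₂'
      (fun x y => Filter.Tendsto (fun j => φ j x) Filter.atTop (nhds w) →
        Filter.Tendsto (fun j => φ j y) Filter.atTop (nhds w)) (fun x hx => ?_)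
      (fun _ _ _ _ _ _ h₁ h₂ h => h₂ (h₁ h)) hP hy hlim
    obtain ⟨R, hR, hball⟩ := Metric.isOpen_iff.1 hΩ_open x hx
    -- Radius `R / 3` makes the step reversible: the disc of radius `2 * R / 3` about `y` stays in
    -- `ball x R`, and its half disc contains `x`.
    filter_upwards [mem_nhdsWithin_of_mem_nhds
      (Metric.ball_mem_nhds x (show 0 < R / 3 by positivity))] with y hy
    rw [Metric.mem_ball] at hy
    refine ⟨fun h => (hunif x R hball h).tendsto_at (Metric.mem_ball.2 (by linarith)),
      fun h => (hunif y (2 * R / 3) ((Metric.ball_subset_ball' (by linarith)).trans hball)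
        h).tendsto_at (Metric.mem_ball'.2 (by linarith))⟩
  intro K hKΩ hK V hV
  have hev : ∀ᶠ j in Filter.atTop, φ j '' K ⊆ V := by
    refine hK.induction_on (p := fun s => ∀ᶠ j in Filter.atTop, φ j '' s ⊆ V) (by simp)
      (fun s t hst h => h.mono fun j hj => (Set.image_mono hst).trans hj)
      (fun s t hs ht => ?_) (fun x hx => ?_)
    · filter_upwards [hs, ht] with j hjs hjt
      rw [Set.image_union]
      exact Set.union_subset hjs hjt
    · obtain ⟨R, hR, hball⟩ := Metric.isOpen_iff.1 hΩ_open x (hKΩ hx)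
      obtain ⟨ε, hε, hεV⟩ := Metric.mem_nhds_iff.1 hV
      refine ⟨Metric.ball x (R / 2), mem_nhdsWithin_of_mem_nhds
        (Metric.ball_mem_nhds x (half_pos hR)), ?_⟩
      filter_upwards [Metric.tendstoUniformlyOn_iff.1 (hunif x R hball (hpt x (hKΩ hx))) ε hε]
        with j hj
      rintro _ ⟨z, hz, rfl⟩
      exact hεV (Metric.mem_ball'.2 (hj z hz))
  obtain ⟨J, hJ⟩ := Filter.eventually_atTop.1 hev
  exact ⟨J + 1, J.succ_pos, fun j hj => hJ j (by omega)⟩
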